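/- \textbf{Setting.} There are $K\ge 1$ arms and $T$ rounds. Fix a finite set $V\subset\mathbb R$ of reward values, a prior $\mathbb P$ carried by a finite set $\mathcal F\subset[0,1]^K$ of mean reward vectors, and a family $(\mathcal D_\nu)_{\nu\in[0,1]}$ of distributions on $V$ such that $\mathcal D_\nu$ has expectation $\nu$ for every $\nu=\mu(a)$ with $\mu\in\mathcal F$ and $a$ an arm. For each $\mu\in\mathcal F$ let $a^*=a^*(\mu)$ be an arm that maximizes $\mu(a)$ (if it is not unique, fix any choice), and let $\mu^*=\max_a\mu(a)$. First $\mu$ is drawn from $\mathbb P$. In each round $t=1,\dots,T$ an algorithm picks an arm $a_t$, at random according to a distribution determined by the history $H_{t-1}=((a_1,r_1),\dots,(a_{t-1},r_{t-1}))$, and then receives a reward $r_t$ drawn independently from $\mathcal D_{\mu(a_t)}$. Its Bayesian regret is $$\mathrm{BR}(T)=\mathbb E_{\mu\sim\mathbb P}\,\mathbb E\Big[\mu^*\,T-\sum_{t=1}^T\mu(a_t)\;\Big|\;\mu\Big].$$ For a $t$-history $H$ that has positive probability under some algorithm, the posterior $\mathbb P_H$ is the conditional distribution of $\mu$ given $H_t=H$,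 when the history is collected by the algorithm that deterministically plays the arms of $H$. \emph{Thompson Sampling} chooses $a_t$, given $H_{t-1}=H$, from the distribution $a\mapsto\mathbb P_H(a^*=a)$. \textbf{Theorem.} The following hold for Thompson Sampling. \begin{enumerate} \item There is an absolute constant $C>0$ such that, for all $K\ge1$ and $T\ge 2$ and every problem as above with $V\subset[0,1]$, $$\mathrm{BR}(T)\le C\sqrt{KT\log T}.$$ In particular $\mathrm{BR}(T)=\tilde O(\sqrt{KT\log T})$. \item For every problem as above, let $U(a,H)$ and $L(a,H)$ be arbitrary real-valued functions of an arm $a$ and a history $H$, and let $r(a,H)=\tfrac12\,(U(a,H)-L(a,H))$. Write $x^-=\max(-x,0)$. If for some $\gamma>0$ $$\mathbb E\big[(U(a,H_{t-1})-\mu(a))^-\big]\le\frac{\gamma}{TK}\quad\text{and}\quad \mathbb E\big[(\mu(a)-L(a,H_{t-1}))^-\big]\le\frac{\gamma}{TK}$$ for all arms $a$ and all rounds $t\in\{1,\dots,T\}$, then $$\mathrm{BR}(T)\le 2\gamma+2\sum_{t=1}^T\mathbb E\big[r(a_t,H_{t-1})\big].$$ \item For every problem as above, every round $t$, every $(t-1)$-history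 $H$ with $\Pr[H_{t-1}=H]>0$ and every arm $a$, $$\Pr[a_t=a\mid H_{t-1}=H]=\Pr[a^*=a\mid H_{t-1}=H].$$ \end{enumerate} -/

import Mathlib

open MeasureTheory ProbabilityTheory

/-- A Bayesian bandit problem with `K` arms, a prior of finite support and finitely many reward
values.  The `bestArm` field fixes the optimal arm `a*` as a function of the mean reward vector;
ties may be broken in any way. -/
structure BayesianBandit (K : ℕ) where
  /-- the finite set of mean reward vectors that carries the prior -/
  vectors : Finset (Fin K → unitInterval)
  /-- the prior distribution of the mean reward vector -/
  prior : PMF vectors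
  /-- the finite set of reward values -/
  values : Finset ℝ
  /-- the single-parameter family of reward distributions, indexed by the mean reward -/
  reward : unitInterval → PMF values
  /-- the distribution with parameter `ν` has expectation `ν`, for every `ν` that occurs -/
  mean_reward : ∀ m ∈ vectors, ∀ a : Fin K,
    ∫ r : values, (r : ℝ) ∂(reward (m a)).toMeasure = (m a : ℝ)
  /-- a best arm for each mean reward vector -/
  bestArm : vectors → Fin K
  bestArm_max : ∀ (m : vectors) (a : Fin K), m.1 a ≤ m.1 (bestArm m)

namespace BayesianBandit

variable {K : ℕ} (B : BayesianBandit K)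

/-- A `t`-history: the arm-reward pairs of the first `t` rounds; index `s : Fin t` is
round `s + 1`. -/
abbrev History (t : ℕ) : Type := Fin t → Fin K × B.values

/-- A (randomized) bandit algorithm: for each history of `t` rounds, the distribution of the arm
chosen in round `t + 1`. -/
abbrev Algorithm : Type := (t : ℕ) → B.History t → PMF (Fin K)

/-- The sub-history `H_t` formed by the first `t` rounds of a `T`-history. -/
def before {T : ℕ} (h : B.History T) (t : Fin T) : B.History t :=
  fun s => h (Fin.castLE t.isLt.le s)

/-- The law of the `t`-history when the algorithm runs on the mean reward vector `m`. -/
noncomputable def historyLaw (alg : B.Algorithm) (m : B.vectors) : (t : ℕ) → PMF (B.History t)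
  | 0 => PMF.pure Fin.elim0
  | t + 1 => (historyLaw alg m t).bind fun h =>
      (alg t h).bind fun a =>
        (B.reward (m.1 a)).map fun r =>
          (Fin.snoc (α := fun _ => Fin K × B.values) h (a, r) : B.History (t + 1))

/-- The joint law of the mean reward vector, drawn from the prior, and the `t`-history. -/
noncomputable def jointLaw (alg : B.Algorithm) (t : ℕ) : PMF (B.vectors × B.History t) :=
  B.prior.bind fun m => (B.historyLaw alg m t).map fun h => (m, h)

/-- The algorithm that deterministically replays the arms of the history `H`
(after that, its choices are immaterial). -/
noncomputable def inducedAlgorithm {t : ℕ} (H : B.History t) : B.Algorithm :=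
  fun s _ => if hs : s < t then PMF.pure (H ⟨s, hs⟩).1 else B.prior.map B.bestArm

/-- `H` is feasible: it has positive probability under the `H`-induced algorithm (equivalently,
under some algorithm). -/
def Feasible {t : ℕ} (H : B.History t) : Prop :=
  ∃ ω ∈ {ω : B.vectors × B.History t | ω.2 = H},
    ω ∈ (B.jointLaw (B.inducedAlgorithm H) t).support

open Classical in
/-- The posterior distribution of the mean reward vector given `H`: its conditional distribution
given that the `t`-history equals `H`, for the `H`-induced algorithm.  (For infeasible `H`, which
never occur, it is the prior by convention.) -/
noncomputable def posterior {t : ℕ} (H : B.History t) : PMF B.vectors :=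
  if hH : B.Feasible H then
    ((B.jointLaw (B.inducedAlgorithm H) t).filter {ω | ω.2 = H} hH).map Prod.fst
  else B.prior

/-- Thompson Sampling: choose each arm with its posterior probability of being the best arm. -/
noncomputable def thompson : B.Algorithm :=
  fun _ H => (B.posterior H).map B.bestArm

/-- The regret `R(T) = μ* T - ∑ₜ μ(aₜ)`. -/
noncomputable def regret {T : ℕ} (m : B.vectors) (h : B.History T) : ℝ :=
  (⨆ a : Fin K, (m.1 a : ℝ)) * T - ∑ t : Fin T, (m.1 (h t).1 : ℝ)

/-- Bayesian regret: the expected regret on a fixed problem instance, in expectation over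
the prior. -/
noncomputable def bayesRegret (alg : B.Algorithm) (T : ℕ) : ℝ :=
  ∫ m, (∫ h, B.regret m h ∂(B.historyLaw alg m T).toMeasure) ∂B.prior.toMeasure

/-- The probability measure that governs the mean reward vector and the `T`-history when
Thompson Sampling is run for `T` rounds. -/
noncomputable def thompsonMeasure (T : ℕ) : Measure (B.vectors × B.History T) :=
  (B.jointLaw B.thompson T).toMeasure

end BayesianBandit

/-! The probability of a history factors into the algorithm's choices, which do not depend on the
mean vector, and the reward likelihood (`expect_historyLaw`). Hence the posterior computed by
replaying arms is also the posterior under Thompson Sampling, and given the past the played arm and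
the best arm have the same law (`expect_thompson`).

So `U` has the same expectation at both arms. Exchanging one for the other bounds the regret of a
round by the width `U - L` at the played arm plus two failures of the confidence bounds
(`bayesRegret_thompson_le`).

For the rate, take average reward plus or minus `radius`. An exponential supermartingale and a union
over the possible counts control the failures (`expect_negPart_le`); Cauchy–Schwarz over the arms
controls the widths (`sum_radius_before_le`). This needs `K ≤ T`; otherwise the trivial bound `T`
suffices. -/

namespace PMF

/-! ### Expectations on finite types -/

variable {α β : Type*} [Fintype α] [Fintype β]

/-- The expectation of a real function under a probability mass function on a finite type. -/
noncomputable def expect (p : PMF α) (f : α → ℝ) : ℝ := ∑ x, (p x).toReal * f x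

lemma integral_eq_expect [MeasurableSpace α] [MeasurableSingletonClass α] (p : PMF α)
    (f : α → ℝ) : ∫ x, f x ∂p.toMeasure = p.expect f := by
  simp [integral_eq_sum, expect]

lemma sum_toReal (p : PMF α) : ∑ x, (p x).toReal = 1 := by
  rw [← ENNReal.toReal_sum fun x _ => p.apply_ne_top x, ← tsum_fintype (L := .unconditional α),
    p.tsum_coe, ENNReal.toReal_one]

@[simp] lemma expect_const (p : PMF α) (c : ℝ) : p.expect (fun _ => c) = c := by
  rw [expect, ← Finset.sum_mul, sum_toReal, one_mul]

lemma expect_mono (p : PMF α) {f g : α → ℝ} (h : ∀ x, f x ≤ g x) : p.expect f ≤ p.expect g :=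
  Finset.sum_le_sum fun x _ => mul_le_mul_of_nonneg_left (h x) ENNReal.toReal_nonneg

lemma expect_le_of_forall_le (p : PMF α) {f : α → ℝ} {c : ℝ} (h : ∀ x, f x ≤ c) :
    p.expect f ≤ c := (p.expect_mono h).trans_eq (p.expect_const c)

lemma expect_add (p : PMF α) (f g : α → ℝ) :
    p.expect (fun x => f x + g x) = p.expect f + p.expect g := by
  simp [expect, mul_add, Finset.sum_add_distrib]

lemma expect_sub (p : PMF α) (f g : α → ℝ) :
    p.expect (fun x => f x - g x) = p.expect f - p.expect g := by
  simp [expect, mul_sub, Finset.sum_sub_distrib]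

lemma expect_const_mul (p : PMF α) (c : ℝ) (f : α → ℝ) :
    p.expect (fun x => c * f x) = c * p.expect f := by
  simp [expect, Finset.mul_sum, mul_left_comm]

lemma expect_sum {ι : Type*} (p : PMF α) (s : Finset ι) (f : ι → α → ℝ) :
    p.expect (fun x => ∑ i ∈ s, f i x) = ∑ i ∈ s, p.expect (f i) := by
  simp only [expect, Finset.mul_sum]
  exact Finset.sum_comm

lemma expect_pure (a : α) (f : α → ℝ) : (PMF.pure a).expect f = f a := by
  classical
  simp [expect, pure_apply, apply_ite ENNReal.toReal]

lemma expect_bind (p : PMF α) (q : α → PMF β) (f : β → ℝ) :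
    (p.bind q).expect f = p.expect fun x => (q x).expect f := by
  have key (y : β) : (p.bind q y).toReal = ∑ x, (p x).toReal * (q x y).toReal := by
    rw [bind_apply, tsum_fintype, ENNReal.toReal_sum]
    · simp
    · exact fun x _ => ENNReal.mul_ne_top (p.apply_ne_top x) ((q x).apply_ne_top y)
  simp only [expect, key, Finset.sum_mul, Finset.mul_sum]
  rw [Finset.sum_comm]
  simp [mul_assoc]

lemma expect_map (p : PMF α) (g : α → β) (f : β → ℝ) :
    (p.map g).expect f = p.expect fun x => f (g x) := by
  rw [← bind_pure_comp, expect_bind]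
  simp [expect_pure]

lemma toMeasure_toReal [MeasurableSpace α] [MeasurableSingletonClass α] (p : PMF α) (s : Set α) :
    (p.toMeasure s).toReal = p.expect (s.indicator 1) := by
  rw [← integral_eq_expect, integral_indicator_one s.toFinite.measurableSet, measureReal_def]

lemma expect_filter (p : PMF α) (s : Set α) (hs : ∃ a ∈ s, a ∈ p.support) (f : α → ℝ) :
    p.expect (s.indicator 1) * (p.filter s hs).expect f = p.expect (s.indicator f) := by
  classical
  have hfin (x : α) : s.indicator p x ≠ ⊤ := by
    by_cases hx : x ∈ s <;> simp [hx, p.apply_ne_top]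
  have hZ : (∑ x, s.indicator p x).toReal = p.expect (s.indicator 1) := by
    rw [ENNReal.toReal_sum fun x _ => hfin x]
    refine Finset.sum_congr rfl fun x _ => ?_
    by_cases hx : x ∈ s <;> simp [hx]
  have hne : p.expect (s.indicator 1) ≠ 0 := by
    rw [← hZ]
    obtain ⟨a, ha, hap⟩ := hs
    refine ENNReal.toReal_ne_zero.2 ⟨?_, ENNReal.sum_ne_top.2 fun x _ => hfin x⟩
    intro h
    rw [Finset.sum_eq_zero_iff] at h
    exact hap (by simpa [ha] using h a (Finset.mem_univ a))
  have h (x : α) : ((p.filter s hs) x).toReal * f x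
      = (p.expect (s.indicator 1))⁻¹ * ((p x).toReal * s.indicator f x) := by
    rw [filter_apply, tsum_fintype, ENNReal.toReal_mul, ENNReal.toReal_inv, hZ]
    by_cases hx : x ∈ s <;> simp [hx]
    ring
  have hsum : (p.filter s hs).expect f = _ := Finset.sum_congr rfl fun x _ => h x
  rw [hsum, ← Finset.mul_sum, mul_inv_cancel_left₀ hne, expect]

lemma expect_indicator_of_forall_notMem_support (p : PMF α) (s : Set α)
    (hs : ¬ ∃ a ∈ s, a ∈ p.support) (f : α → ℝ) : p.expect (s.indicator f) = 0 := by
  refine Finset.sum_eq_zero fun x _ => ?_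
  by_cases hx : x ∈ s
  · have : p x = 0 := by
      by_contra h
      exact hs ⟨x, hx, h⟩
    simp [this]
  · simp [hx]

end PMF

/-! ### The law of histories, Bayes' rule and exchangeability -/

namespace BayesianBandit

variable {K : ℕ} (B : BayesianBandit K)

/-- The history `h` extended by one round. -/
abbrev extend {t : ℕ} (h : B.History t) (x : Fin K × B.values) : B.History (t + 1) :=
  Fin.snoc (α := fun _ => Fin K × B.values) h x

lemma before_extend_castSucc {t : ℕ} (h : B.History t) (x : Fin K × B.values) (s : Fin t) :
    B.before (B.extend h x) s.castSucc = B.before h s := by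
  funext i
  exact Fin.snoc_castSucc (α := fun _ => Fin K × B.values) x h (Fin.castLE s.isLt.le i)

lemma before_extend_last {t : ℕ} (h : B.History t) (x : Fin K × B.values) :
    B.before (B.extend h x) (Fin.last t) = h := by
  funext i
  exact Fin.snoc_castSucc (α := fun _ => Fin K × B.values) x h i

lemma extend_last {t : ℕ} (h : B.History t) (x : Fin K × B.values) :
    B.extend h x (Fin.last t) = x := Fin.snoc_last (α := fun _ => Fin K × B.values) x h

lemma extend_castSucc {t : ℕ} (h : B.History t) (x : Fin K × B.values) (s : Fin t) :
    B.extend h x s.castSucc = h s := Fin.snoc_castSucc (α := fun _ => Fin K × B.values) x h s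

lemma expect_historyLaw_succ (alg : B.Algorithm) (m : B.vectors) (t : ℕ)
    (f : B.History (t + 1) → ℝ) :
    (B.historyLaw alg m (t + 1)).expect f = (B.historyLaw alg m t).expect fun h =>
      (alg t h).expect fun a => (B.reward (m.1 a)).expect fun r => f (B.extend h (a, r)) := by
  simp [historyLaw, PMF.expect_bind, PMF.expect_map]

lemma expect_jointLaw (alg : B.Algorithm) (t : ℕ) (f : B.vectors × B.History t → ℝ) :
    (B.jointLaw alg t).expect f =
      B.prior.expect fun m => (B.historyLaw alg m t).expect fun h => f (m, h) := by
  simp [jointLaw, PMF.expect_bind, PMF.expect_map]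

/-- The law of the first `t` rounds and of the arm of round `t + 1`. -/
lemma expect_before (alg : B.Algorithm) (m : B.vectors) {T : ℕ} (t : Fin T)
    (f : B.History t → Fin K → ℝ) :
    (B.historyLaw alg m T).expect (fun h => f (B.before h t) (h t).1) =
      (B.historyLaw alg m t).expect fun h => (alg t h).expect (f h) := by
  induction T with
  | zero => exact t.elim0
  | succ T ih =>
    rw [expect_historyLaw_succ]
    induction t using Fin.lastCases with
    | last => simp only [before_extend_last, extend_last, PMF.expect_const, Fin.val_last]
    | cast s =>
      simp only [before_extend_castSucc, extend_castSucc, PMF.expect_const]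
      exact ih s f

/-- The contribution of the algorithm to the probability of a history. -/
noncomputable def algorithmWeight (alg : B.Algorithm) {t : ℕ} (h : B.History t) : ℝ :=
  ∏ s : Fin t, (alg s (B.before h s) (h s).1).toReal

/-- The contribution of the rewards to the probability of a history. -/
noncomputable def likelihood (m : B.vectors) {t : ℕ} (h : B.History t) : ℝ :=
  ∏ s : Fin t, (B.reward (m.1 (h s).1) (h s).2).toReal

/-- Each round contributes one choice factor and one reward factor. Only the latter involves `m`, so
the former cancels in Bayes' rule. -/
lemma expect_historyLaw (alg : B.Algorithm) (m : B.vectors) (t : ℕ) (f : B.History t → ℝ) :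
    (B.historyLaw alg m t).expect f =
      ∑ h, B.algorithmWeight alg h * B.likelihood m h * f h := by
  induction t with
  | zero =>
    rw [historyLaw, PMF.expect_pure, Fintype.sum_unique]
    simp [algorithmWeight, likelihood]
    congr 1
  | succ t ih =>
    rw [expect_historyLaw_succ, ih,
      ← (Fin.snocEquiv fun _ : Fin (t + 1) => Fin K × B.values).sum_comp, Fintype.sum_prod_type,
      Finset.sum_comm]
    refine Finset.sum_congr rfl fun h _ => ?_
    rw [Fintype.sum_prod_type]
    simp only [PMF.expect, Finset.mul_sum]
    refine Finset.sum_congr rfl fun a _ => Finset.sum_congr rfl fun r _ => ?_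
    change _ = B.algorithmWeight alg (B.extend h (a, r)) * B.likelihood m (B.extend h (a, r)) *
      f (B.extend h (a, r))
    simp only [algorithmWeight, likelihood, Fin.prod_univ_castSucc, before_extend_castSucc,
      extend_castSucc, extend_last, before_extend_last, Fin.val_last, Fin.val_castSucc]
    ring

lemma algorithmWeight_inducedAlgorithm {t : ℕ} (H : B.History t) :
    B.algorithmWeight (B.inducedAlgorithm H) H = 1 := by
  simp [algorithmWeight, inducedAlgorithm]

lemma expect_inducedAlgorithm_indicator {t : ℕ} (H : B.History t) (g : B.vectors → ℝ) :
    (B.jointLaw (B.inducedAlgorithm H) t).expect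
        ({ω : B.vectors × B.History t | ω.2 = H}.indicator fun ω => g ω.1) =
      B.prior.expect fun m => B.likelihood m H * g m := by
  classical
  rw [expect_jointLaw]
  congr 1
  funext m
  rw [expect_historyLaw, Finset.sum_eq_single H]
  · simp [algorithmWeight_inducedAlgorithm]
  · intro h _ hh
    simp [hh]
  · simp

/-- Bayes' rule for the posterior. -/
lemma expect_posterior {t : ℕ} (H : B.History t) (g : B.vectors → ℝ) :
    (B.prior.expect fun m => B.likelihood m H) * (B.posterior H).expect g =
      B.prior.expect fun m => B.likelihood m H * g m := by
  have h1 := B.expect_inducedAlgorithm_indicator H (fun _ => 1)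
  have hg := B.expect_inducedAlgorithm_indicator H g
  simp only [mul_one] at h1
  by_cases hH : B.Feasible H
  · rw [posterior, dif_pos hH, PMF.expect_map, ← h1, ← hg]
    exact PMF.expect_filter _ _ hH _
  -- An infeasible history has total likelihood zero, so both sides vanish whatever the default
  -- posterior.
  · rw [← h1, ← hg, PMF.expect_indicator_of_forall_notMem_support _ _ hH,
      PMF.expect_indicator_of_forall_notMem_support _ _ hH, zero_mul]

/-- Under Thompson Sampling the chosen arm and the best arm are exchangeable, jointly with the
history of the earlier rounds. -/
lemma expect_thompson {T : ℕ} (t : Fin T) (f : B.History t → Fin K → ℝ) :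
    (B.jointLaw B.thompson T).expect (fun ω => f (B.before ω.2 t) (ω.2 t).1) =
      (B.jointLaw B.thompson T).expect (fun ω => f (B.before ω.2 t) (B.bestArm ω.1)) := by
  have swap (F : B.vectors → B.History t → ℝ) :
      (B.prior.expect fun m => (B.historyLaw B.thompson m t).expect (F m)) =
        ∑ h, B.algorithmWeight B.thompson h *
          B.prior.expect fun m => B.likelihood m h * F m h := by
    simp only [expect_historyLaw, PMF.expect_sum, mul_assoc, PMF.expect_const_mul]
  rw [expect_jointLaw, expect_jointLaw]
  simp only [expect_before]
  simp only [fun m => B.expect_before B.thompson m t fun h _ => f h (B.bestArm m),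
    PMF.expect_const]
  rw [swap, swap fun m h => f h (B.bestArm m)]
  refine Finset.sum_congr rfl fun h _ => ?_
  rw [← B.expect_posterior h fun m => f h (B.bestArm m), thompson, PMF.expect_map]
  congr 1
  rw [mul_comm, ← PMF.expect_const_mul]
  simp only [mul_comm]

/-- Both sides share the normalizing factor; what remains is exchangeability applied to the
indicator of `(H, a)`. -/
lemma cond_thompsonMeasure (T : ℕ) (t : Fin T) (H : B.History t) (a : Fin K) :
    (B.thompsonMeasure T)[{ω | (ω.2 t).1 = a} | {ω | B.before ω.2 t = H}] =
      (B.thompsonMeasure T)[{ω | B.bestArm ω.1 = a} | {ω | B.before ω.2 t = H}] := by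
  classical
  have hm : MeasurableSet {ω : B.vectors × B.History T | B.before ω.2 t = H} :=
    (Set.toFinite _).measurableSet
  rw [cond_apply hm, cond_apply hm]
  congr 1
  rw [thompsonMeasure, ← ENNReal.toReal_eq_toReal_iff' (measure_ne_top _ _) (measure_ne_top _ _),
    PMF.toMeasure_toReal, PMF.toMeasure_toReal]
  convert B.expect_thompson t fun h b => if h = H ∧ b = a then 1 else 0 using 2 <;>
  · funext ω
    simp [Set.indicator_apply]

/-! ### Regret from confidence bounds -/

lemma iSup_mean (m : B.vectors) : (⨆ a : Fin K, (m.1 a : ℝ)) = m.1 (B.bestArm m) := by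
  have : Nonempty (Fin K) := ⟨B.bestArm m⟩
  exact le_antisymm (ciSup_le fun a => B.bestArm_max m a)
    (le_ciSup (f := fun a : Fin K => (m.1 a : ℝ)) (Set.finite_range _).bddAbove (B.bestArm m))

lemma bayesRegret_eq (alg : B.Algorithm) (T : ℕ) :
    B.bayesRegret alg T = ∑ t : Fin T, (B.jointLaw alg T).expect fun ω =>
      (ω.1.1 (B.bestArm ω.1) : ℝ) - ω.1.1 (ω.2 t).1 := by
  rw [← PMF.expect_sum, expect_jointLaw]
  simp only [bayesRegret, PMF.integral_eq_expect, regret, iSup_mean, Finset.sum_sub_distrib]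
  simp [mul_comm]

/-- The hypotheses concern fixed arms, but the bounds are used at random ones. Summing over all arms
costs the factor `K` in `γ / (T * K)`. -/
lemma sub_le_sum_negPart {ι : Type*} [Fintype ι] (u : ι → ℝ) (i : ι) : -u i ≤ ∑ j, (u j)⁻ :=
  (neg_le_negPart _).trans (Finset.single_le_sum (f := fun j => (u j)⁻)
    (fun j _ => negPart_nonneg (u j)) (Finset.mem_univ i))

lemma card_pos (B : BayesianBandit K) : 0 < K := (B.bestArm B.prior.support_nonempty.some).pos

/-- The Bayesian regret of Thompson Sampling is controlled by any confidence bounds. -/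
theorem bayesRegret_thompson_le (T : ℕ) (U L : Fin K → (t : ℕ) → B.History t → ℝ) (γ : ℝ)
    (hγ : 0 < γ)
    (hU : ∀ (a : Fin K) (t : Fin T),
        ∫ ω, (U a t (B.before ω.2 t) - (ω.1.1 a : ℝ))⁻ ∂B.thompsonMeasure T
          ≤ γ / ((T : ℝ) * K))
    (hL : ∀ (a : Fin K) (t : Fin T),
        ∫ ω, ((ω.1.1 a : ℝ) - L a t (B.before ω.2 t))⁻ ∂B.thompsonMeasure T
          ≤ γ / ((T : ℝ) * K)) :
    B.bayesRegret B.thompson T ≤ 2 * γ + 2 * ∑ t : Fin T,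
        ∫ ω, (U (ω.2 t).1 t (B.before ω.2 t) - L (ω.2 t).1 t (B.before ω.2 t)) / 2
          ∂B.thompsonMeasure T := by
  simp only [thompsonMeasure, PMF.integral_eq_expect] at hU hL ⊢
  set p := B.jointLaw B.thompson T
  have hK : (0 : ℝ) < K := by exact_mod_cast B.card_pos
  have round (t : Fin T) :
      p.expect (fun ω => (ω.1.1 (B.bestArm ω.1) : ℝ) - ω.1.1 (ω.2 t).1) ≤ 2 * (γ / T) +
        2 * p.expect (fun ω =>
          (U (ω.2 t).1 t (B.before ω.2 t) - L (ω.2 t).1 t (B.before ω.2 t)) / 2) := by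
    have hT : (0 : ℝ) < T := by exact_mod_cast t.pos
    have sumle (F : Fin K → B.vectors × B.History T → ℝ)
        (hF : ∀ a, p.expect (fun ω => (F a ω)⁻) ≤ γ / ((T : ℝ) * K)) :
        p.expect (fun ω => ∑ a, (F a ω)⁻) ≤ γ / T := by
      rw [PMF.expect_sum]
      refine (Finset.sum_le_sum fun a _ => hF a).trans_eq ?_
      simp
      field_simp
    have hUs := sumle _ fun a => hU a t
    have hLs := sumle _ fun a => hL a t
    have hex : p.expect (fun ω => U (ω.2 t).1 t (B.before ω.2 t)) =
        p.expect fun ω => U (B.bestArm ω.1) t (B.before ω.2 t) :=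
      B.expect_thompson t fun h a => U a t h
    rw [← PMF.expect_const_mul]
    -- The last two terms of `g` cancel in expectation by `hex`, the only use of Thompson Sampling
    -- here.
    refine (p.expect_mono
      (g := fun ω => ((((∑ a, (U a t (B.before ω.2 t) - (ω.1.1 a : ℝ))⁻)
          + ∑ a, ((ω.1.1 a : ℝ) - L a t (B.before ω.2 t))⁻)
          + 2 * ((U (ω.2 t).1 t (B.before ω.2 t) - L (ω.2 t).1 t (B.before ω.2 t)) / 2))
          + U (B.bestArm ω.1) t (B.before ω.2 t)) - U (ω.2 t).1 t (B.before ω.2 t)) fun ω => ?_).trans ?_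
    · have h1 := sub_le_sum_negPart (fun a => U a t (B.before ω.2 t) - (ω.1.1 a : ℝ))
        (B.bestArm ω.1)
      have h2 := sub_le_sum_negPart (fun a => (ω.1.1 a : ℝ) - L a t (B.before ω.2 t)) (ω.2 t).1
      linarith
    · rw [PMF.expect_sub, PMF.expect_add, PMF.expect_add, PMF.expect_add]
      linarith
  rw [bayesRegret_eq]
  refine (Finset.sum_le_sum fun t _ => round t).trans ?_
  rw [Finset.sum_add_distrib, ← Finset.mul_sum, ← Finset.mul_sum]
  gcongr
  rcases Nat.eq_zero_or_pos T with rfl | hT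
  · simp [hγ.le]
  · have : (T : ℝ) ≠ 0 := by positivity
    simp
    field_simp
    rfl

/-! ### Concentration of the average rewards -/

/-- The number of rounds in which the arm `a` is played. -/
def count {t : ℕ} (h : B.History t) (a : Fin K) : ℕ := ∑ s : Fin t, if (h s).1 = a then 1 else 0

/-- The total reward of the arm `a`. -/
noncomputable def totalReward {t : ℕ} (h : B.History t) (a : Fin K) : ℝ :=
  ∑ s : Fin t, if (h s).1 = a then ((h s).2 : ℝ) else 0

/-- The average reward of the arm `a` (zero if the arm was never played). -/
noncomputable def averageReward {t : ℕ} (h : B.History t) (a : Fin K) : ℝ :=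
  B.totalReward h a / B.count h a

lemma count_extend {t : ℕ} (h : B.History t) (x : Fin K × B.values) (a : Fin K) :
    B.count (B.extend h x) a = B.count h a + if x.1 = a then 1 else 0 := by
  simp only [count, Fin.sum_univ_castSucc, extend_castSucc, extend_last]

lemma totalReward_extend {t : ℕ} (h : B.History t) (x : Fin K × B.values) (a : Fin K) :
    B.totalReward (B.extend h x) a = B.totalReward h a + if x.1 = a then (x.2 : ℝ) else 0 := by
  simp only [totalReward, Fin.sum_univ_castSucc, extend_castSucc, extend_last]

lemma count_le {t : ℕ} (h : B.History t) (a : Fin K) : B.count h a ≤ t := by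
  refine (Finset.sum_le_card_nsmul _ _ 1 fun s _ => ?_).trans_eq (by simp)
  split_ifs <;> simp

lemma sum_count {t : ℕ} (h : B.History t) : ∑ a, B.count h a = t := by
  simp only [count]
  rw [Finset.sum_comm]
  simp

lemma averageReward_mem_Icc (hv : ∀ r ∈ B.values, 0 ≤ r ∧ r ≤ 1) {t : ℕ} (h : B.History t)
    (a : Fin K) : B.averageReward h a ∈ Set.Icc (0 : ℝ) 1 := by
  constructor
  · refine div_nonneg (Finset.sum_nonneg fun s _ => ?_) (Nat.cast_nonneg _)
    split_ifs
    exacts [(hv _ (h s).2.2).1, le_rfl]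
  · refine div_le_one_of_le₀ ?_ (Nat.cast_nonneg _)
    rw [totalReward, count, Nat.cast_sum]
    refine Finset.sum_le_sum fun s _ => ?_
    split_ifs
    · simpa using (hv _ (h s).2.2).2
    · simp

/-- Hoeffding's lemma for the reward of an arm. -/
lemma expect_exp_reward_le (hv : ∀ r ∈ B.values, 0 ≤ r ∧ r ≤ 1) (m : B.vectors) (a : Fin K)
    (l : ℝ) : ((B.reward (m.1 a)).expect fun r => Real.exp (l * ((r : ℝ) - m.1 a) - l ^ 2 / 8))
      ≤ 1 := by
  have h := (hasSubgaussianMGF_of_mem_Icc (μ := (B.reward (m.1 a)).toMeasure)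
    (X := fun r : B.values => (r : ℝ)) (a := 0) (b := 1) measurable_subtype_coe.aemeasurable
    (.of_forall fun r => hv r r.2)).mgf_le l
  rw [B.mean_reward m.1 m.2 a, mgf, PMF.integral_eq_expect] at h
  have h8 : ((((‖(1 : ℝ) - 0‖₊ / 2) ^ 2 : NNReal) : ℝ)) * l ^ 2 / 2 = l ^ 2 / 8 := by
    simp
    ring
  rw [h8] at h
  calc _ = (B.reward (m.1 a)).expect fun r =>
        Real.exp (-(l ^ 2 / 8)) * Real.exp (l * ((r : ℝ) - m.1 a)) := by
        congr 1
        funext r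
        rw [← Real.exp_add]
        congr 1
        ring
    _ ≤ Real.exp (-(l ^ 2 / 8)) * Real.exp (l ^ 2 / 8) := by
        rw [PMF.expect_const_mul]
        gcongr
    _ = 1 := by rw [← Real.exp_add, neg_add_cancel, Real.exp_zero]

/-- The exponential supermartingale of the rewards of the arm `a`. -/
noncomputable def expDeviation (m : B.vectors) (a : Fin K) (l : ℝ) {t : ℕ} (h : B.History t) : ℝ :=
  Real.exp (l * (B.totalReward h a - B.count h a * m.1 a) - l ^ 2 / 8 * B.count h a)

/-- Given the past, a play of `a` multiplies the process by a factor of mean at most one, and any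
other arm leaves it unchanged; adaptive choices do no harm. -/
lemma expect_expDeviation_le (hv : ∀ r ∈ B.values, 0 ≤ r ∧ r ≤ 1) (alg : B.Algorithm)
    (m : B.vectors) (a : Fin K) (l : ℝ) (t : ℕ) :
    (B.historyLaw alg m t).expect (B.expDeviation m a l) ≤ 1 := by
  induction t with
  | zero => simp [historyLaw, PMF.expect_pure, expDeviation, totalReward, count]
  | succ t ih =>
    rw [expect_historyLaw_succ]
    refine (PMF.expect_mono _ fun h => ?_).trans ih
    refine PMF.expect_le_of_forall_le _ fun b => ?_
    by_cases hb : b = a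
    · subst hb
      calc _ = (B.reward (m.1 b)).expect fun r => B.expDeviation m b l h *
            Real.exp (l * ((r : ℝ) - m.1 b) - l ^ 2 / 8) := by
            congr 1
            funext r
            simp only [expDeviation, count_extend, totalReward_extend, if_true]
            rw [← Real.exp_add]
            congr 1
            push_cast
            ring
        _ ≤ B.expDeviation m b l h * 1 := by
            rw [PMF.expect_const_mul]
            exact mul_le_mul_of_nonneg_left (B.expect_exp_reward_le hv m b l) (Real.exp_nonneg _)
        _ = _ := mul_one _
    · simp [expDeviation, count_extend, totalReward_extend, hb]

/-- The confidence radius after `n` plays. -/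
noncomputable def radius (T n : ℕ) : ℝ := 2 * √(Real.log T / (n + 1))

lemma radius_nonneg (T n : ℕ) : 0 ≤ radius T n := by unfold radius; positivity

/-- An unplayed arm has default average zero, hence error at most one, which this radius covers. -/
lemma one_le_radius_zero {T : ℕ} (hT : 2 ≤ T) : 1 ≤ radius T 0 := by
  have h2 : Real.log 2 ≤ Real.log T := Real.log_le_log two_pos (by exact_mod_cast hT)
  have h3 := Real.log_two_gt_d9
  have : (1 / 2 : ℝ) ≤ √(Real.log T) := Real.le_sqrt_of_sq_le (by norm_num; linarith)
  simp [radius]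
  linarith

lemma log_le_mul_radius_sq {T n : ℕ} (hn : n ≠ 0) :
    4 * Real.log T ≤ 2 * n * radius T n ^ 2 := by
  have hlog : 0 ≤ Real.log T := Real.log_natCast_nonneg T
  have h1 : (1 : ℝ) ≤ n := by exact_mod_cast Nat.one_le_iff_ne_zero.2 hn
  rw [radius, mul_pow, Real.sq_sqrt (by positivity)]
  rw [show 2 * (n : ℝ) * (2 ^ 2 * (Real.log T / (n + 1))) =
    4 * Real.log T * (2 * n / (n + 1)) by ring]
  refine le_mul_of_one_le_right (by positivity) ?_
  rw [le_div_iff₀ (by positivity)]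
  linarith

lemma one_le_exp_mul_inv_pow {T : ℕ} (hT : 2 ≤ T) {x : ℝ} (hx : 4 * Real.log T ≤ x) :
    1 ≤ Real.exp x * ((T : ℝ) ^ 4)⁻¹ := by
  have hT0 : (0 : ℝ) < T := by positivity
  have : Real.exp (4 * Real.log T) = (T : ℝ) ^ 4 := by
    rw [← Real.exp_log (pow_pos hT0 4), Real.log_pow]
    norm_num
  rw [← div_eq_mul_inv, one_le_div (by positivity), ← this]
  exact Real.exp_le_exp.2 hx

/-- One-sided deviations of the average reward; `σ = 1` and `σ = -1` give the two sides. -/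
lemma negPart_le_sum_expDeviation (hv : ∀ r ∈ B.values, 0 ≤ r ∧ r ≤ 1) {T t : ℕ} (hT : 2 ≤ T)
    (ht : t < T) (m : B.vectors) (a : Fin K) (h : B.History t) {σ : ℝ} (hσ : σ = 1 ∨ σ = -1) :
    (σ * (B.averageReward h a - m.1 a) + radius T (B.count h a))⁻ ≤
      ∑ n ∈ Finset.range T, B.expDeviation m a (-(4 * σ * radius T n)) h * ((T : ℝ) ^ 4)⁻¹ := by
  have hterm (n : ℕ) :
      0 ≤ B.expDeviation m a (-(4 * σ * radius T n)) h * ((T : ℝ) ^ 4)⁻¹ :=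
    mul_nonneg (Real.exp_nonneg _) (by positivity)
  have hsq : σ ^ 2 = 1 := by rcases hσ with rfl | rfl <;> norm_num
  have hx := B.averageReward_mem_Icc hv h a
  have hm := (m.1 a).2
  have hr := radius_nonneg T (B.count h a)
  have habs : -1 ≤ σ * (B.averageReward h a - m.1 a) := by
    rcases hσ with rfl | rfl <;> linarith [hx.1, hx.2, hm.1, hm.2]
  by_cases hpos : 0 ≤ σ * (B.averageReward h a - m.1 a) + radius T (B.count h a)
  · rw [negPart_eq_zero.2 hpos]
    exact Finset.sum_nonneg fun n _ => hterm n
  push Not at hpos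
  have hn : B.count h a ≠ 0 := by
    intro h0
    rw [h0] at hpos
    linarith [one_le_radius_zero hT]
  -- The count is random, so the exponential parameter cannot be tuned to it in advance. The sum
  -- offers every possible value, and the actual one is selected.
  refine le_trans ?_ (Finset.single_le_sum (fun n _ => hterm n)
    (Finset.mem_range.2 ((B.count_le h a).trans_lt ht)))
  -- The negative part never exceeds one, so it suffices that the selected summand is at least one.
  refine le_trans (b := 1) (by rw [negPart_of_nonpos hpos.le]; linarith) ?_
  refine one_le_exp_mul_inv_pow hT ((log_le_mul_radius_sq hn).trans ?_)
  have hn0 : (0 : ℝ) < B.count h a := by exact_mod_cast Nat.pos_of_ne_zero hn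
  have htot : B.totalReward h a = B.count h a * B.averageReward h a := by
    rw [averageReward]
    field_simp
  rw [htot]
  set n : ℝ := (B.count h a : ℝ)
  set r := radius T (B.count h a)
  set d := B.averageReward h a - (m.1 a : ℝ) with hd
  -- With parameter `-4σr` the exponent is `-4σrnd - 2nr²`, and `σd < -r` makes it at least `2nr²`.
  have : (4 * n * r) * (σ * d + r) ≤ 0 := mul_nonpos_of_nonneg_of_nonpos (by positivity) hpos.le
  calc 2 * n * r ^ 2 ≤ 2 * n * r ^ 2 - (4 * n * r) * (σ * d + r) := by linarith
    _ = -(4 * σ * r) * (n * d) - (4 * r) ^ 2 * 1 / 8 * n := by ring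
    _ = _ := by rw [← hsq, hd]; ring

lemma expect_negPart_le (hv : ∀ r ∈ B.values, 0 ≤ r ∧ r ≤ 1) {T : ℕ} (hT : 2 ≤ T) (hKT : K ≤ T)
    (alg : B.Algorithm) (a : Fin K) (t : Fin T) {σ : ℝ} (hσ : σ = 1 ∨ σ = -1) :
    (B.jointLaw alg T).expect (fun ω => (σ * (B.averageReward (B.before ω.2 t) a - ω.1.1 a) +
      radius T (B.count (B.before ω.2 t) a))⁻) ≤ 1 / ((T : ℝ) * K) := by
  have hK : (0 : ℝ) < K := by exact_mod_cast B.card_pos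
  have hT0 : (0 : ℝ) < T := by positivity
  have hT1 : (1 : ℝ) ≤ T := by exact_mod_cast (by omega : 1 ≤ T)
  have hKT' : (K : ℝ) ≤ T := by exact_mod_cast hKT
  rw [expect_jointLaw]
  refine PMF.expect_le_of_forall_le _ fun m => ?_
  rw [B.expect_before alg m t fun h _ =>
    (σ * (B.averageReward h a - m.1 a) + radius T (B.count h a))⁻]
  simp only [PMF.expect_const]
  refine (PMF.expect_mono _ fun h =>
    B.negPart_le_sum_expDeviation hv hT t.2 m a h hσ).trans ?_
  rw [PMF.expect_sum]
  calc _ ≤ ∑ n ∈ Finset.range T, ((T : ℝ) ^ 4)⁻¹ := by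
        refine Finset.sum_le_sum fun n _ => ?_
        simp only [mul_comm _ ((T : ℝ) ^ 4)⁻¹]
        rw [PMF.expect_const_mul]
        exact mul_le_of_le_one_right (by positivity) (B.expect_expDeviation_le hv alg m a _ t)
    _ = 1 / (T : ℝ) ^ 3 := by
        simp
        field_simp
    _ ≤ 1 / ((T : ℝ) * K) := by
        apply one_div_le_one_div_of_le (by positivity)
        calc (T : ℝ) * K ≤ T * T := by gcongr
          _ ≤ T * T * T := le_mul_of_one_le_right (by positivity) hT1
          _ = (T : ℝ) ^ 3 := by ring

/-! ### Summing the radii, and the final rate -/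

/-- Successive plays of one arm see the earlier counts `0, 1, 2, …`, so regrouping rounds by arm
gives initial segments. -/
lemma sum_radius_eq (T : ℕ) {t : ℕ} (h : B.History t) :
    ∑ s, radius T (B.count (B.before h s) (h s).1) =
      ∑ a, ∑ n ∈ Finset.range (B.count h a), radius T n := by
  induction t with
  | zero => simp [count]
  | succ t ih =>
    obtain ⟨h, x, rfl⟩ : ∃ h' x, h = B.extend h' x :=
      ⟨Fin.init h, h (Fin.last t), (Fin.snoc_init_self h).symm⟩
    have hsum (a : Fin K) : ∑ n ∈ Finset.range (B.count (B.extend h x) a), radius T n =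
        (∑ n ∈ Finset.range (B.count h a), radius T n) +
          if x.1 = a then radius T (B.count h a) else 0 := by
      rw [count_extend]
      split_ifs <;> simp [Finset.sum_range_succ]
    simp only [hsum, Finset.sum_add_distrib]
    rw [Fin.sum_univ_castSucc, ← ih]
    simp only [before_extend_castSucc, extend_castSucc, extend_last, before_extend_last]
    simp

lemma sum_radius_le (T n : ℕ) :
    ∑ i ∈ Finset.range n, radius T i ≤ 4 * √(Real.log T) * √n := by
  induction n with
  | zero => simp
  | succ n ih =>
    rw [Finset.sum_range_succ]
    have hn : (0 : ℝ) < √((n : ℝ) + 1) := Real.sqrt_pos.2 (by positivity)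
    -- This makes the sum telescope.
    have key : 1 / √((n : ℝ) + 1) ≤ 2 * (√((n : ℝ) + 1) - √n) := by
      rw [div_le_iff₀ hn]
      nlinarith [Real.sq_sqrt (by positivity : (0 : ℝ) ≤ (n : ℝ) + 1),
        Real.sq_sqrt (by positivity : (0 : ℝ) ≤ (n : ℝ)), sq_nonneg (√((n : ℝ) + 1) - √n)]
    have hlog : 0 ≤ Real.log T := Real.log_natCast_nonneg T
    have := mul_le_mul_of_nonneg_left key (by positivity : 0 ≤ 2 * √(Real.log T))
    rw [radius, Real.sqrt_div hlog]
    push_cast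
    rw [mul_one_div] at this
    rw [← mul_div_assoc]
    linarith

lemma sum_radius_before_le {T : ℕ} (h : B.History T) :
    ∑ s, radius T (B.count (B.before h s) (h s).1) ≤ 4 * √((K : ℝ) * T * Real.log T) := by
  rw [sum_radius_eq]
  refine (Finset.sum_le_sum fun a _ => sum_radius_le T (B.count h a)).trans ?_
  rw [← Finset.mul_sum, mul_comm ((K : ℝ) * T), Real.sqrt_mul (Real.log_natCast_nonneg T),
    mul_assoc]
  gcongr
  apply Real.le_sqrt_of_sq_le
  -- Cauchy–Schwarz over the `K` arms, whose counts add up to `T`.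
  refine sq_sum_le_card_mul_sum_sq.trans_eq ?_
  simp only [Real.sq_sqrt (Nat.cast_nonneg _)]
  rw [← Nat.cast_sum, sum_count]
  simp

/-- The Bayesian regret of Thompson Sampling is at most of order `√(K T log T)`. -/
theorem bayesRegret_thompson_le_sqrt (hv : ∀ r ∈ B.values, 0 ≤ r ∧ r ≤ 1) {T : ℕ} (hT : 2 ≤ T) :
    B.bayesRegret B.thompson T ≤ 10 * √((K : ℝ) * T * Real.log T) := by
  have hK : (1 : ℝ) ≤ K := by exact_mod_cast B.card_pos
  have hT2 : (2 : ℝ) ≤ T := by exact_mod_cast hT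
  have hlog : 1 / 2 ≤ Real.log T := by
    linarith [Real.log_le_log two_pos hT2, Real.log_two_gt_d9]
  rcases le_or_gt K T with hKT | hKT
  · have main := B.bayesRegret_thompson_le T
      (fun a t h => B.averageReward h a + radius T (B.count h a))
      (fun a t h => B.averageReward h a - radius T (B.count h a)) 1 one_pos
      (fun a t => by
        rw [thompsonMeasure, PMF.integral_eq_expect]
        convert B.expect_negPart_le hv hT hKT B.thompson a t (.inl rfl) using 4
        ring)
      (fun a t => by
        rw [thompsonMeasure, PMF.integral_eq_expect]
        convert B.expect_negPart_le hv hT hKT B.thompson a t (.inr rfl) using 4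
        ring)
    have hrad : ∑ t : Fin T, (B.jointLaw B.thompson T).expect (fun ω =>
        radius T (B.count (B.before ω.2 t) (ω.2 t).1)) ≤ 4 * √((K : ℝ) * T * Real.log T) := by
      rw [← PMF.expect_sum]
      exact PMF.expect_le_of_forall_le _ fun ω => B.sum_radius_before_le ω.2
    have hdiff (x y : ℝ) : (x + y - (x - y)) / 2 = y := by ring
    simp only [thompsonMeasure, PMF.integral_eq_expect, hdiff] at main
    -- Absorbs `2γ = 2`; with `2 * 4` from the radii this gives the constant 10.
    have hone : 1 ≤ √((K : ℝ) * T * Real.log T) := by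
      refine Real.le_sqrt_of_sq_le ?_
      have : (2 : ℝ) ≤ K * T := by nlinarith
      nlinarith
    linarith
  · have hKT' : (T : ℝ) ≤ K := by exact_mod_cast hKT.le
    -- With more arms than rounds, a regret of at most one per round is already good enough.
    have hle : B.bayesRegret B.thompson T ≤ T := by
      rw [bayesRegret_eq]
      refine (Finset.sum_le_sum (g := fun _ => (1 : ℝ)) fun t _ => ?_).trans_eq (by simp)
      refine PMF.expect_le_of_forall_le _ fun ω => ?_
      linarith [(ω.1.1 (B.bestArm ω.1)).2.2, (ω.1.1 (ω.2 t).1).2.1]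
    have : (T : ℝ) / 2 ≤ √((K : ℝ) * T * Real.log T) := by
      refine Real.le_sqrt_of_sq_le ?_
      calc ((T : ℝ) / 2) ^ 2 ≤ T * T * (1 / 2) := by nlinarith
        _ ≤ K * T * Real.log T := by gcongr
    linarith

end BayesianBandit

theorem mainTheorem4 :
    -- Bayesian regret of Thompson Sampling, with an absolute constant
    (∃ C : ℝ, 0 < C ∧ ∀ (K T : ℕ) (B : BayesianBandit K), 2 ≤ T →
      (∀ r ∈ B.values, 0 ≤ r ∧ r ≤ 1) →
      B.bayesRegret B.thompson T ≤ C * Real.sqrt ((K : ℝ) * T * Real.log T)) ∧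
    -- the general bound for arbitrary confidence bounds; index `t : Fin T` is round `t + 1`
    (∀ (K T : ℕ) (B : BayesianBandit K) (U L : Fin K → (t : ℕ) → B.History t → ℝ) (γ : ℝ),
      0 < γ →
      (∀ (a : Fin K) (t : Fin T),
        ∫ ω, (U a t (B.before ω.2 t) - (ω.1.1 a : ℝ))⁻ ∂B.thompsonMeasure T
          ≤ γ / ((T : ℝ) * K)) →
      (∀ (a : Fin K) (t : Fin T),
        ∫ ω, ((ω.1.1 a : ℝ) - L a t (B.before ω.2 t))⁻ ∂B.thompsonMeasure T
          ≤ γ / ((T : ℝ) * K)) →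
      B.bayesRegret B.thompson T ≤ 2 * γ + 2 * ∑ t : Fin T,
        ∫ ω, (U (ω.2 t).1 t (B.before ω.2 t) - L (ω.2 t).1 t (B.before ω.2 t)) / 2
          ∂B.thompsonMeasure T) ∧
    -- given the history, the chosen arm and the best arm are identically distributed
    (∀ (K T : ℕ) (B : BayesianBandit K) (t : Fin T) (H : B.History t) (a : Fin K),
      B.thompsonMeasure T {ω | B.before ω.2 t = H} ≠ 0 →
      (B.thompsonMeasure T)[{ω | (ω.2 t).1 = a} | {ω | B.before ω.2 t = H}] =
        (B.thompsonMeasure T)[{ω | B.bestArm ω.1 = a} | {ω | B.before ω.2 t = H}]) := by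
  exact ⟨⟨10, by norm_num, fun _ _ B hT hv => B.bayesRegret_thompson_le_sqrt hv hT⟩,
    fun _ T B U L γ hγ hU hL => B.bayesRegret_thompson_le T U L γ hγ hU hL,
    fun _ T B t H a _ => B.cond_thompsonMeasure T t H a⟩
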